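/- Let $\mathcal S,\mathcal A$ be finite non-empty sets, $\gamma\in[0,1)$, $c:\mathcal S\times\mathcal A\to[0,1]$ a constraint reward with $c_{\max}=\max_{s,a}c(s,a)$, $b\in\mathbb R$, $\rho$ an initial distribution on $\mathcal S$, and $\delta\in(0,1)$. For transition probabilities $P(\cdot\mid s,a)$ and a stationary stochastic policy $\pi$ let $$V_c^\pi(\rho)=\mathbb E\Big[\sum_{t\ge 0}\gamma^t c(s_t,a_t)\Big],\qquad s_0\sim\rho,\ a_t\sim\pi(\cdot\mid s_t),\ s_{t+1}\sim P(\cdot\mid s_t,a_t),$$ and let $\zeta=\max_\pi V_c^\pi(\rho)-b$ be the Slater constant. An algorithm knows $\mathcal S,\mathcal A,\gamma,c,b,\rho,\delta$, but neither $P$ nor $\zeta$. It draws independent samples from $P(\cdot\mid s,a)$, equally many for every pair $(s,a)$, and after each round of samples it decides, from the samples seen so far, whether to halt and what to output. **Theorem.** There are absolute constants $\kappa,K>0$ such that for all $\mathcal S,\mathcal A,\gamma,c,b,\rho,\delta$ as above there is an algorithm with the following property: for every $P$ with $0<\zeta\le\frac1{1-\gamma}$, with probability at least $1-\delta$ the algorithm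 halts, having taken at most $$K\,\frac{c_{\max}\,\log\!\Big(\frac{|\mathcal S||\mathcal A|}{(1-\gamma)\,\delta\,\zeta}\Big)}{(1-\gamma)^3\zeta^2}$$ samples per state-action pair, and outputs $\hat\zeta$ with $|\hat\zeta-\zeta|\le 0.2\,\zeta$. Moreover, unless $|\mathcal S|=|\mathcal A|=1$, the algorithm is the following doubling procedure. Put $\zeta_i=2^{-i}/(1-\gamma)$ and $$N_i=\left\lfloor\frac{\kappa\, c_{\max}\log\!\Big(\frac{2|\mathcal S||\mathcal A|(i+1)^2}{(1-\gamma)\zeta_i\delta}\Big)}{(1-\gamma)^3\zeta_i^2}\right\rfloor .$$ For $i=0,1,2,\dots$, draw $N_i$ fresh samples of every state-action pair, form the empirical transition probabilities $\hat P_i$ (uniform if $N_i=0$), and compute the optimal value $\hat V^*_{c,i}(\rho)$ of the empirical MDP $(\mathcal S,\mathcal A,\hat P_i,c,\rho,\gamma)$. Stop at the first $i$ with $|\hat V^*_{c,i}(\rho)-b|\ge 9\zeta_i$, and output $\hat\zeta=\hat V^*_{c,i}(\rho)-b$. -/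

import Mathlib

open MeasureTheory
open scoped ENNReal BigOperators

namespace SlaterEstimation

noncomputable section

/-! ### Discounted Markov decision processes -/

/-- The law of the state `s_t` when `s_0 ∼ ρ`, `a_t ∼ π(· | s_t)`, `s_{t+1} ∼ P(· | s_t, a_t)`. -/
def stateLaw {S A : Type*} (P : S → A → PMF S) (ρ : PMF S) (π : S → PMF A) : ℕ → PMF S
  | 0 => ρ
  | t + 1 => (stateLaw P ρ π t).bind fun s => (π s).bind fun a => P s a

/-- The expectation of `c (s_t, a_t)` under the stationary stochastic policy `π`. -/
def expectedReward {S A : Type*} [Fintype S] [Fintype A] (P : S → A → PMF S) (ρ : PMF S)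
    (c : S → A → ℝ) (π : S → PMF A) (t : ℕ) : ℝ :=
  ∑ s, ∑ a, (stateLaw P ρ π t s).toReal * (π s a).toReal * c s a

/-- The value function `V_c^π(ρ) = E [∑_t γ^t c(s_t, a_t)]`. -/
def value {S A : Type*} [Fintype S] [Fintype A] (P : S → A → PMF S) (ρ : PMF S) (γ : ℝ)
    (c : S → A → ℝ) (π : S → PMF A) : ℝ :=
  ∑' t : ℕ, γ ^ t * expectedReward P ρ c π t

/-- The optimal value `V_c^*(ρ)`, over all stationary stochastic policies. -/
def optimalValue {S A : Type*} [Fintype S] [Fintype A] (P : S → A → PMF S) (ρ : PMF S) (γ : ℝ)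
    (c : S → A → ℝ) : ℝ :=
  ⨆ π : S → PMF A, value P ρ γ c π

/-- The Slater constant `ζ = max_π V_c^π(ρ) - b`. -/
def slater {S A : Type*} [Fintype S] [Fintype A] (P : S → A → PMF S) (ρ : PMF S) (γ : ℝ)
    (c : S → A → ℝ) (b : ℝ) : ℝ :=
  optimalValue P ρ γ c - b

/-- The largest constraint reward `c_max = max_{s,a} c(s,a)`. -/
def cMax {S A : Type*} (c : S → A → ℝ) : ℝ :=
  ⨆ p : S × A, c p.1 p.2

/-! ### Access to the generative model -/

/-- The law of an infinite table of mutually independent samples from the generative model: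
the entry `ω (j, s, a)`, with law `P(· | s, a)`, is the `j`-th sample drawn at `(s, a)`. -/
def sampleLaw {S A : Type*} [MeasurableSpace S] (P : S → A → PMF S) :
    Measure (ℕ × S × A → S) :=
  Measure.infinitePi fun i : ℕ × S × A => (P i.2.1 i.2.2).toMeasure

/-- The first `n` samples of every state-action pair. -/
def history {S A : Type*} (ω : ℕ × S × A → S) (n : ℕ) : Fin n → S → A → S :=
  fun j s a => ω ((j : ℕ), s, a)

/-- A sequential estimation algorithm. Having drawn `n` samples of every state-action pair it sees
these samples, and nothing else of the unknown transition probabilities, and either halts with a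
real number as its output (`some z`) or draws one more sample of every pair (`none`). -/
abbrev SamplingAlgorithm (S A : Type*) : Type _ :=
  (n : ℕ) → (Fin n → S → A → S) → Option ℝ

/-- On the sample table `ω` the algorithm halts after exactly `n` samples per state-action pair,
with output `z`. -/
def HaltsWith {S A : Type*} (alg : SamplingAlgorithm S A) (ω : ℕ × S × A → S) (n : ℕ) (z : ℝ) :
    Prop :=
  (∀ m < n, alg m (history ω m) = none) ∧ alg n (history ω n) = some z

/-! ### The doubling procedure -/

/-- The empirical transition probabilities `P̂(s' | s, a) = N(s' | s, a) / N` formed from `N` samples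
of every state-action pair (for `N = 0`, the uniform distribution). -/
def empirical {S A : Type*} [Fintype S] [Nonempty S] :
    (N : ℕ) → (Fin N → S → A → S) → S → A → PMF S
  | 0, _ => fun _ _ => PMF.uniformOfFintype S
  | N + 1, d => fun s a => (PMF.uniformOfFintype (Fin (N + 1))).map fun j => d j s a

theorem empirical_apply {S A : Type*} [Fintype S] [Nonempty S] [DecidableEq S] {N : ℕ} (hN : N ≠ 0)
    (d : Fin N → S → A → S) (s : S) (a : A) (s' : S) :
    empirical N d s a s' = ((Finset.univ.filter fun j => d j s a = s').card : ℝ≥0∞) / N := by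
  obtain ⟨N, rfl⟩ := Nat.exists_eq_succ_of_ne_zero hN
  simp only [empirical, PMF.map_apply, PMF.uniformOfFintype_apply, tsum_fintype, Fintype.card_fin]
  rw [← Finset.sum_filter, Finset.sum_const, nsmul_eq_mul, div_eq_mul_inv]
  congr 3
  ext j
  simp [eq_comm]

/-- The accuracy `ζ_i = 2^{-i} / (1 - γ)` of run `i`. -/
def accuracy (γ : ℝ) (i : ℕ) : ℝ := (1 / 2) ^ i / (1 - γ)

/-- The number of samples per state-action pair in run `i = 0, 1, 2, …`: the integer part of
`κ c_max log (2 |S| |A| (i+1)² / ((1-γ) ζ_i δ)) / ((1-γ)³ ζ_i²)`. -/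
def runSize {S A : Type*} [Fintype S] [Fintype A] (κ γ : ℝ) (c : S → A → ℝ) (δ : ℝ) (i : ℕ) : ℕ :=
  ⌊κ * cMax c * Real.log (2 * ((Fintype.card S : ℝ) * (Fintype.card A : ℝ)) * ((i : ℝ) + 1) ^ 2 /
      ((1 - γ) * accuracy γ i * δ)) / ((1 - γ) ^ 3 * accuracy γ i ^ 2)⌋₊

/-- The number of samples per state-action pair used by the runs `0, …, i - 1` together. -/
def runStart {S A : Type*} [Fintype S] [Fintype A] (κ γ : ℝ) (c : S → A → ℝ) (δ : ℝ) (i : ℕ) : ℕ :=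
  ∑ j ∈ Finset.range i, runSize κ γ c δ j

/-- The empirical optimal value `V̂*_{c,i}(ρ)` found in run `i` by planning, with the constraint
reward, in the empirical MDP formed from the samples of that run. These are the last `runSize i` of
the `n = runStart (i + 1)` samples of every pair drawn so far. -/
def runValue {S A : Type*} [Fintype S] [Fintype A] [Nonempty S] (κ γ : ℝ) (c : S → A → ℝ)
    (ρ : PMF S) (δ : ℝ) (i n : ℕ) (hn : runStart κ γ c δ (i + 1) = n) (d : Fin n → S → A → S) : ℝ :=
  optimalValue
    (empirical (runSize κ γ c δ i) fun j =>
      d ⟨runStart κ γ c δ i + j, by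
        rw [← hn, runStart, runStart, Finset.sum_range_succ]
        exact Nat.add_lt_add_left j.2 _⟩)
    ρ γ c

/-- Run `i` ends after `n` samples per state-action pair, and then its test
`|V̂*_{c,i}(ρ) - b| ≥ 9 ζ_i` succeeds. -/
def RunStops {S A : Type*} [Fintype S] [Fintype A] [Nonempty S] (κ γ : ℝ) (c : S → A → ℝ) (b : ℝ)
    (ρ : PMF S) (δ : ℝ) (n : ℕ) (d : Fin n → S → A → S) (i : ℕ) : Prop :=
  ∃ hn : runStart κ γ c δ (i + 1) = n, 9 * accuracy γ i ≤ |runValue κ γ c ρ δ i n hn d - b|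

open Classical in
/-- The doubling procedure: perform the runs `i = 0, 1, 2, …`, each on fresh samples, until the test
of some run succeeds, and then output `V̂*_{c,i}(ρ) - b` for this run. -/
def doublingAlgorithm {S A : Type*} [Fintype S] [Fintype A] [Nonempty S] (κ γ : ℝ)
    (c : S → A → ℝ) (b : ℝ) (ρ : PMF S) (δ : ℝ) : SamplingAlgorithm S A :=
  fun n d =>
    if h : ∃ i, RunStops κ γ c b ρ δ n d i then
      some (runValue κ γ c ρ δ (Nat.find h) n (Nat.find_spec h).choose d - b)
    else none

end

end SlaterEstimation

/-! Everything reduces to one estimate: with about `log / ((1-γ)³ ε²)` samples per pair, the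
empirical optimal value is within `ε` of the true one. Run `i` uses it with `ε = ζ_i` and failure
probability `δ / 2^(i+1)`, so with probability at least `1 - δ` all runs are accurate at once. From
then on the argument is deterministic (`exists_first_success`): a run with `10 ζ_i ≤ ζ` must pass
its test, and a passed test forces `ζ ≥ 8 ζ_i`, hence relative error at most `1/8`. The first
success therefore has `ζ ≤ 20 ζ_i`, and since run sizes are dominated by a geometric series of ratio
4, the total cost is of the order of the bound for the last run.

The cube of `1 / (1-γ)` needs a total-variance argument. Let `W` and `U` be the optimal value
functions for the true kernel `P` and the empirical kernel `Q`. As `W` does not depend on the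
samples, a Bernstein bound for each pair and a union bound over pairs control `Q W - P W` by `l`
times the empirical second moment of `W` about its true mean, plus a small constant
(`sampleLaw_deviation_le`). Instead of summing variances along trajectories, `IsBellman.abs_sub_le`
adds the potential `3 l W² - 6 l M U` to `±(U - W)`. Its one-step drift under `Q` cancels the
variance term, and the discounted maximum principle leaves an error of only `6 l M² + 3 η / (1-γ)`.
-/

namespace SlaterEstimation

/-! ### Expectations under a probability mass function -/

/-- The expectation of `f` under `μ`. -/
noncomputable def mean {S : Type*} [Fintype S] (μ : PMF S) (f : S → ℝ) : ℝ :=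
  ∑ s, (μ s).toReal * f s

section Mean

variable {S : Type*} [Fintype S] (μ : PMF S)

theorem sum_toReal_eq_one : ∑ s, (μ s).toReal = 1 := by
  have h := μ.tsum_coe
  rw [tsum_fintype] at h
  rw [← ENNReal.toReal_sum (fun s _ => μ.apply_ne_top s), h, ENNReal.toReal_one]

theorem mean_add (f g : S → ℝ) : mean μ (fun s => f s + g s) = mean μ f + mean μ g := by
  simp only [mean, mul_add, Finset.sum_add_distrib]

theorem mean_sub (f g : S → ℝ) : mean μ (fun s => f s - g s) = mean μ f - mean μ g := by
  simp only [mean, mul_sub, Finset.sum_sub_distrib]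

theorem mean_const_mul (k : ℝ) (f : S → ℝ) : mean μ (fun s => k * f s) = k * mean μ f := by
  simp only [mean, Finset.mul_sum]
  exact Finset.sum_congr rfl fun s _ => by ring

theorem mean_const (k : ℝ) : mean μ (fun _ => k) = k := by
  rw [mean, ← Finset.sum_mul, sum_toReal_eq_one, one_mul]

theorem mean_mono {f g : S → ℝ} (h : ∀ s, f s ≤ g s) : mean μ f ≤ mean μ g :=
  Finset.sum_le_sum fun s _ => mul_le_mul_of_nonneg_left (h s) ENNReal.toReal_nonneg

theorem mean_nonneg {f : S → ℝ} (h : ∀ s, 0 ≤ f s) : 0 ≤ mean μ f :=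
  Finset.sum_nonneg fun s _ => mul_nonneg ENNReal.toReal_nonneg (h s)

theorem mean_le {f : S → ℝ} {k : ℝ} (h : ∀ s, f s ≤ k) : mean μ f ≤ k :=
  (mean_mono μ h).trans_eq (mean_const μ k)

theorem le_mean {f : S → ℝ} {k : ℝ} (h : ∀ s, k ≤ f s) : k ≤ mean μ f :=
  (mean_const μ k).symm.trans_le (mean_mono μ h)

theorem abs_mean_sub_le {f g : S → ℝ} {k : ℝ} (h : ∀ s, |f s - g s| ≤ k) :
    |mean μ f - mean μ g| ≤ k := by
  rw [← mean_sub, abs_le]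
  exact ⟨le_mean μ fun s => (abs_le.1 (h s)).1, mean_le μ fun s => (abs_le.1 (h s)).2⟩

theorem mean_sub_sq (f : S → ℝ) (k : ℝ) :
    mean μ (fun s => (f s - k) ^ 2) = mean μ (fun s => f s ^ 2) - 2 * k * mean μ f + k ^ 2 := by
  have h : (fun s => (f s - k) ^ 2) = fun s => (f s ^ 2 - (2 * k) * f s) + k ^ 2 := by
    ext s; ring
  rw [h, mean_add, mean_sub, mean_const_mul, mean_const]

theorem mean_bind {T : Type*} [Fintype T] (κ : S → PMF T) (f : T → ℝ) :
    mean (μ.bind κ) f = mean μ fun s => mean (κ s) f := by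
  simp only [mean, PMF.bind_apply, tsum_fintype]
  have h : ∀ t, (∑ s, μ s * κ s t).toReal = ∑ s, (μ s).toReal * (κ s t).toReal := fun t => by
    rw [ENNReal.toReal_sum fun s _ => ENNReal.mul_ne_top (μ.apply_ne_top s) ((κ s).apply_ne_top t)]
    simp only [ENNReal.toReal_mul]
  simp only [h, Finset.sum_mul, Finset.mul_sum]
  rw [Finset.sum_comm]
  exact Finset.sum_congr rfl fun s _ => Finset.sum_congr rfl fun t _ => by ring

theorem mean_pure (s : S) (f : S → ℝ) : mean (PMF.pure s) f = f s := by
  classical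
  rw [mean, Finset.sum_eq_single s]
  · simp
  · intro t _ ht
    simp [ht]
  · simp

end Mean

/-! ### The Bellman optimality equation -/

section Bellman

variable {S A : Type*} [Fintype S]

/-- `W` solves the Bellman optimality equation of the MDP with transition probabilities `P`. -/
def IsBellman (P : S → A → PMF S) (γ : ℝ) (c : S → A → ℝ) (W : S → ℝ) : Prop :=
  (∀ s a, c s a + γ * mean (P s a) W ≤ W s) ∧ ∀ s, ∃ a, W s = c s a + γ * mean (P s a) W

theorem exists_isBellman [Fintype A] [Nonempty A] (P : S → A → PMF S) {γ : ℝ} (c : S → A → ℝ)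
    (hγ : 0 ≤ γ) (hγ1 : γ < 1) : ∃ W, IsBellman P γ c W := by
  let T : (S → ℝ) → S → ℝ := fun W s =>
    Finset.univ.sup' Finset.univ_nonempty fun a => c s a + γ * mean (P s a) W
  have hT : ∀ V W : S → ℝ, ∀ s, T V s ≤ T W s + γ * dist V W := fun V W s => by
    refine Finset.sup'_le _ _ fun a ha => ?_
    have h1 := Finset.le_sup' (fun a => c s a + γ * mean (P s a) W) ha
    have h2 := (abs_le.1 (abs_mean_sub_le (P s a) (f := V) (g := W) fun s =>
      (Real.dist_eq _ _).symm.trans_le (dist_le_pi_dist V W s))).2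
    have h3 := mul_le_mul_of_nonneg_left h2 hγ
    change _ ≤ T W s at h1
    linarith
  have hc : ContractingWith ⟨γ, hγ⟩ T := by
    refine ⟨by exact_mod_cast hγ1, LipschitzWith.of_dist_le_mul fun V W => ?_⟩
    refine (dist_pi_le_iff (mul_nonneg hγ dist_nonneg)).2 fun s => ?_
    rw [Real.dist_eq, abs_le]
    have h1 := hT V W s
    have h2 := hT W V s
    rw [dist_comm W V] at h2
    change -(γ * dist V W) ≤ _ ∧ _ ≤ γ * dist V W
    constructor <;> linarith
  refine ⟨hc.fixedPoint T, fun s a => ?_, fun s => ?_⟩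
  · conv_rhs => rw [← hc.fixedPoint_isFixedPt.eq]
    exact Finset.le_sup' (fun a => c s a + γ * mean (P s a) (hc.fixedPoint T))
      (Finset.mem_univ a)
  · obtain ⟨a, -, ha⟩ := Finset.exists_mem_eq_sup' Finset.univ_nonempty
      fun a => c s a + γ * mean (P s a) (hc.fixedPoint T)
    refine ⟨a, ?_⟩
    conv_lhs => rw [← hc.fixedPoint_isFixedPt.eq]
    exact ha

/-- A maximum principle for discounted transition kernels. -/
theorem le_div_of_le_mean [Nonempty S] (P : S → A → PMF S) {γ k : ℝ} (hγ : 0 ≤ γ) (hγ1 : γ < 1)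
    {F : S → ℝ} (h : ∀ s, ∃ a, F s ≤ γ * mean (P s a) F + k) (s : S) : F s ≤ k / (1 - γ) := by
  obtain ⟨t, ht⟩ := Finite.exists_max F
  obtain ⟨a, ha⟩ := h t
  have h1 := mul_le_mul_of_nonneg_left (mean_le (P t a) ht) hγ
  refine (ht s).trans ?_
  rw [le_div_iff₀ (by linarith)]
  linarith

theorem IsBellman.nonneg [Nonempty S] [Nonempty A] {P : S → A → PMF S} {γ : ℝ} {c : S → A → ℝ}
    {W : S → ℝ} (hW : IsBellman P γ c W) (hγ : 0 ≤ γ) (hγ1 : γ < 1) (hc : ∀ s a, 0 ≤ c s a)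
    (s : S) : 0 ≤ W s := by
  have h := le_div_of_le_mean P (k := 0) hγ hγ1 (F := fun s => (-1) * W s) (fun s => by
    obtain ⟨a⟩ := ‹Nonempty A›
    refine ⟨a, ?_⟩
    rw [mean_const_mul]
    linarith [hW.1 s a, hc s a]) s
  rw [zero_div] at h
  linarith

theorem IsBellman.le [Nonempty S] {P : S → A → PMF S} {γ : ℝ} {c : S → A → ℝ} {W : S → ℝ} {C : ℝ}
    (hW : IsBellman P γ c W) (hγ : 0 ≤ γ) (hγ1 : γ < 1) (hc : ∀ s a, c s a ≤ C) (s : S) :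
    W s ≤ C / (1 - γ) :=
  le_div_of_le_mean P hγ hγ1 (fun s => by
    obtain ⟨a, ha⟩ := hW.2 s
    exact ⟨a, by linarith [hc s a]⟩) s

variable [Fintype A] (P : S → A → PMF S) (ρ : PMF S) {γ : ℝ} {c : S → A → ℝ}

theorem expectedReward_eq_mean (π : S → PMF A) (t : ℕ) :
    expectedReward P ρ c π t = mean (stateLaw P ρ π t) fun s => mean (π s) (c s) := by
  simp only [expectedReward, mean, Finset.mul_sum, mul_assoc]

theorem mean_stateLaw_succ (π : S → PMF A) (t : ℕ) (W : S → ℝ) :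
    mean (stateLaw P ρ π (t + 1)) W =
      mean (stateLaw P ρ π t) fun s => mean (π s) fun a => mean (P s a) W := by
  rw [stateLaw, mean_bind]
  simp only [mean_bind]

theorem expectedReward_nonneg (hc : ∀ s a, 0 ≤ c s a) (π : S → PMF A) (t : ℕ) :
    0 ≤ expectedReward P ρ c π t := by
  rw [expectedReward_eq_mean]
  exact mean_nonneg _ fun s => mean_nonneg _ (hc s)

variable {P}

theorem IsBellman.expectedReward_le {W : S → ℝ} (hW : IsBellman P γ c W) (π : S → PMF A) (t : ℕ) :
    expectedReward P ρ c π t ≤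
      mean (stateLaw P ρ π t) W - γ * mean (stateLaw P ρ π (t + 1)) W := by
  rw [expectedReward_eq_mean, mean_stateLaw_succ, ← mean_const_mul, ← mean_sub]
  refine mean_mono _ fun s => ?_
  rw [← mean_const_mul, le_sub_iff_add_le, ← mean_add]
  exact mean_le _ (hW.1 s)

theorem expectedReward_greedy {W : S → ℝ} {g : S → A}
    (hg : ∀ s, W s = c s (g s) + γ * mean (P s (g s)) W) (t : ℕ) :
    expectedReward P ρ c (fun s => PMF.pure (g s)) t =
      mean (stateLaw P ρ (fun s => PMF.pure (g s)) t) W -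
        γ * mean (stateLaw P ρ (fun s => PMF.pure (g s)) (t + 1)) W := by
  rw [expectedReward_eq_mean, mean_stateLaw_succ, ← mean_const_mul, ← mean_sub]
  congr 1
  ext s
  rw [mean_pure, mean_pure]
  linarith [hg s]

theorem sum_telescope_discount (γ : ℝ) (x : ℕ → ℝ) (n : ℕ) :
    ∑ t ∈ Finset.range n, γ ^ t * (x t - γ * x (t + 1)) = x 0 - γ ^ n * x n := by
  induction n with
  | zero => simp
  | succ n ih => rw [Finset.sum_range_succ, ih]; ring

/-- Each expected reward is at most a discounted difference of expectations of `W`, so the partial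
sums telescope, and the leftover tail is nonnegative because `W` is. -/
theorem IsBellman.value_le [Nonempty S] [Nonempty A] {W : S → ℝ} (hW : IsBellman P γ c W)
    (hγ : 0 ≤ γ) (hγ1 : γ < 1) (hc : ∀ s a, 0 ≤ c s a) (π : S → PMF A) :
    value P ρ γ c π ≤ mean ρ W := by
  refine Real.tsum_le_of_sum_range_le
    (fun t => mul_nonneg (pow_nonneg hγ t) (expectedReward_nonneg P ρ hc π t)) fun n => ?_
  calc _ ≤ ∑ t ∈ Finset.range n, γ ^ t *
        (mean (stateLaw P ρ π t) W - γ * mean (stateLaw P ρ π (t + 1)) W) :=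
        Finset.sum_le_sum fun t _ =>
          mul_le_mul_of_nonneg_left (hW.expectedReward_le ρ π t) (pow_nonneg hγ t)
    _ = mean ρ W - γ ^ n * mean (stateLaw P ρ π n) W :=
        sum_telescope_discount γ (fun t => mean (stateLaw P ρ π t) W) n
    _ ≤ mean ρ W := sub_le_self _ (mul_nonneg (pow_nonneg hγ n)
        (mean_nonneg _ (hW.nonneg hγ hγ1 hc)))

theorem IsBellman.value_greedy [Nonempty S] [Nonempty A] {W : S → ℝ} (hW : IsBellman P γ c W)
    (hγ : 0 ≤ γ) (hγ1 : γ < 1) (hc : ∀ s a, 0 ≤ c s a) {g : S → A}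
    (hg : ∀ s, W s = c s (g s) + γ * mean (P s (g s)) W) :
    value P ρ γ c (fun s => PMF.pure (g s)) = mean ρ W := by
  obtain ⟨C, hC⟩ := (Set.finite_range W).bddAbove
  refine HasSum.tsum_eq ((hasSum_iff_tendsto_nat_of_nonneg (fun t => mul_nonneg (pow_nonneg hγ t)
    (expectedReward_nonneg P ρ hc _ t)) _).2 ?_)
  have h : ∀ n, ∑ t ∈ Finset.range n,
      γ ^ t * expectedReward P ρ c (fun s => PMF.pure (g s)) t =
      mean ρ W - γ ^ n * mean (stateLaw P ρ (fun s => PMF.pure (g s)) n) W := fun n => by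
    simp only [expectedReward_greedy ρ hg]
    exact sum_telescope_discount γ
      (fun t => mean (stateLaw P ρ (fun s => PMF.pure (g s)) t) W) n
  simp only [h]
  have h0 : Filter.Tendsto
      (fun n => γ ^ n * mean (stateLaw P ρ (fun s => PMF.pure (g s)) n) W) Filter.atTop
      (nhds 0) := by
    refine squeeze_zero (fun n => mul_nonneg (pow_nonneg hγ n)
      (mean_nonneg _ (hW.nonneg hγ hγ1 hc))) (fun n => mul_le_mul_of_nonneg_left
        (mean_le _ fun s => hC ⟨s, rfl⟩) (pow_nonneg hγ n)) ?_
    simpa using (tendsto_pow_atTop_nhds_zero_of_lt_one hγ hγ1).mul_const C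
  simpa using tendsto_const_nhds.sub h0

theorem IsBellman.optimalValue_eq [Nonempty S] [Nonempty A] {W : S → ℝ} (hW : IsBellman P γ c W)
    (hγ : 0 ≤ γ) (hγ1 : γ < 1) (hc : ∀ s a, 0 ≤ c s a) :
    optimalValue P ρ γ c = mean ρ W := by
  choose g hg using hW.2
  have hle := hW.value_le ρ hγ hγ1 hc
  have : Nonempty (S → PMF A) := ⟨fun s => PMF.pure (g s)⟩
  refine le_antisymm (ciSup_le hle) ?_
  rw [← hW.value_greedy ρ hγ hγ1 hc hg]
  exact le_ciSup (f := fun π => value P ρ γ c π) ⟨mean ρ W, by rintro _ ⟨π, rfl⟩; exact hle π⟩ _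

end Bellman

/-! ### Sensitivity of the optimal value to the transition probabilities -/

section Sensitivity

variable {S A : Type*} [Fintype S]

/-- The variance step of the total-variance argument, at a single state-action pair: `w` and `r`
are the value and the reward, `p` and `q₁` the true and the empirical mean of the value, `q₂` the
empirical mean of its square. -/
theorem discounted_deviation_le {γ l M η w r p q₁ q₂ : ℝ} (hγ : 0 ≤ γ) (hγ1 : γ < 1) (hl : 0 ≤ l)
    (hlM : l * M ≤ 1 / 12) (hw : 0 ≤ w) (hwM : w ≤ M) (hη : 0 ≤ η) (hr : 0 ≤ r)
    (hp : 0 ≤ p ∧ p ≤ M) (hq : 0 ≤ q₁ ∧ q₁ ≤ M) (hg : r + γ * p ≤ w)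
    (h : |q₁ - p| ≤ l * (q₂ - 2 * p * q₁ + p ^ 2) + η) :
    γ * |q₁ - p| ≤ 3 * l * (γ * q₂ - w ^ 2) + 6 * l * M * (w - γ * p) + 3 * η := by
  set m := q₁ - p with hm
  have hmM : |m| ≤ M := abs_le.2 ⟨by linarith [hp.2, hq.1], by linarith [hp.1, hq.2]⟩
  have hm0 := abs_nonneg m
  have h1 : l * m ^ 2 ≤ |m| / 12 := by
    have : l * (|m| * |m|) ≤ l * (M * |m|) :=
      mul_le_mul_of_nonneg_left (mul_le_mul_of_nonneg_right hmM hm0) hl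
    have h2 := mul_le_mul_of_nonneg_right hlM hm0
    rw [← sq_abs]
    nlinarith
  -- Moving the centre from `p` to `q₁` costs `l * m ^ 2`, which `h1` absorbs into the left side.
  have h2 : |m| ≤ 2 * l * (q₂ - q₁ ^ 2) + 2 * η := by
    have : q₂ - 2 * p * q₁ + p ^ 2 = (q₂ - q₁ ^ 2) + m ^ 2 := by rw [hm]; ring
    rw [this, mul_add] at h
    linarith
  -- The variance becomes a drift of `w ^ 2`: write `γ * q₁` as `w` minus a remainder and drop the
  -- square of the remainder. The term in `|m|` is again absorbed at the end.
  have h3 : γ * (q₂ - q₁ ^ 2) ≤ γ * q₂ - w ^ 2 + 2 * M * (w - γ * p + γ * |m|) := by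
    have e : γ * q₁ = w - (w - γ * p - γ * m) := by rw [hm]; ring
    have h4 : (γ * q₁) ^ 2 ≤ γ * q₁ ^ 2 := by
      rw [mul_pow]
      exact mul_le_mul_of_nonneg_right (by nlinarith) (sq_nonneg _)
    have h5 : w ^ 2 - 2 * (w * (w - γ * p - γ * m)) ≤ (γ * q₁) ^ 2 := by
      rw [e]; nlinarith [sq_nonneg (w - γ * p - γ * m)]
    have h6 : w * (w - γ * p - γ * m) ≤ M * (w - γ * p + γ * |m|) := by
      have h7 : w - γ * p - γ * m ≤ w - γ * p + γ * |m| := by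
        have := mul_le_mul_of_nonneg_left (neg_abs_le m) hγ
        linarith
      have h8 : 0 ≤ w - γ * p + γ * |m| := by
        have := mul_nonneg hγ hm0
        linarith
      exact (mul_le_mul_of_nonneg_left h7 hw).trans (mul_le_mul_of_nonneg_right hwM h8)
    linarith
  have h4 := mul_le_mul_of_nonneg_left h2 hγ
  have h5 := mul_le_mul_of_nonneg_left h3 hl
  have h6 : l * M * (γ * |m|) ≤ 1 / 12 * (γ * |m|) :=
    mul_le_mul_of_nonneg_right hlM (mul_nonneg hγ hm0)
  have h7 : γ * η ≤ η := by nlinarith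
  nlinarith

/-- In the potential, `3 l W²` offsets the variance drift from `key`, while `-6 l M U` pays for the
reward part of `6 l M (W - γ P W)`. What remains of that term is the Bellman gap `W - c - γ P W`. -/
theorem IsBellman.abs_sub_le [Nonempty S] [Nonempty A] {P Q : S → A → PMF S} {γ l M η : ℝ}
    {c : S → A → ℝ} {W U : S → ℝ} (hW : IsBellman P γ c W) (hU : IsBellman Q γ c U) (hγ : 0 ≤ γ)
    (hγ1 : γ < 1) (hc : ∀ s a, 0 ≤ c s a) (hWM : ∀ s, W s ≤ M) (hUM : ∀ s, U s ≤ M) (hl : 0 ≤ l)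
    (hlM : l * M ≤ 1 / 12) (hη : 0 ≤ η)
    (h : ∀ s a, |mean (Q s a) W - mean (P s a) W| ≤
      l * mean (Q s a) (fun t => (W t - mean (P s a) W) ^ 2) + η) (s : S) :
    |U s - W s| ≤ 6 * l * M ^ 2 + 3 * η / (1 - γ) := by
  have hW0 := hW.nonneg hγ hγ1 hc
  have hU0 := hU.nonneg hγ hγ1 hc
  have hM : 0 ≤ M := (hW0 s).trans (hWM s)
  have key : ∀ s a, γ * |mean (Q s a) W - mean (P s a) W| ≤
      3 * l * (γ * mean (Q s a) (fun t => W t ^ 2) - W s ^ 2) +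
        6 * l * M * (W s - γ * mean (P s a) W) + 3 * η := fun s a => by
    have h1 := h s a
    rw [mean_sub_sq] at h1
    exact discounted_deviation_le hγ hγ1 hl hlM (hW0 s) (hWM s) hη (hc s a)
      ⟨mean_nonneg _ hW0, mean_le _ hWM⟩ ⟨mean_nonneg _ hW0, mean_le _ hWM⟩ (hW.1 s a) h1
  have hlM0 : 0 ≤ l * M := mul_nonneg hl hM
  have hlU : ∀ s, 6 * l * M * U s ≤ 6 * l * M ^ 2 := fun s => by
    nlinarith [mul_le_mul_of_nonneg_left (hUM s) hlM0]
  have hlW : ∀ s, 0 ≤ 3 * l * W s ^ 2 := fun s => by positivity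
  have hmean : ∀ (x : ℝ) s a, mean (Q s a) (fun t => x * U t + (-x) * W t + 3 * l * W t ^ 2 -
      6 * l * M * U t) = x * mean (Q s a) U + (-x) * mean (Q s a) W +
        3 * l * mean (Q s a) (fun t => W t ^ 2) - 6 * l * M * mean (Q s a) U := fun x s a => by
    rw [mean_sub, mean_add, mean_add, mean_const_mul, mean_const_mul, mean_const_mul,
      mean_const_mul]
  have upper := le_div_of_le_mean Q (k := 3 * η) hγ hγ1
    (F := fun t => 1 * U t + (-1) * W t + 3 * l * W t ^ 2 - 6 * l * M * U t) (fun s => by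
      -- An action optimal for `U` may be suboptimal for `W`. Its gap enters `U - W` with a minus
      -- sign, and `6 l M ≤ 1/2` lets it absorb the gap coming from `key` (this is `h3`).
      obtain ⟨a, ha⟩ := hU.2 s
      refine ⟨a, ?_⟩
      rw [hmean]
      have h1 := key s a
      have h2 := mul_le_mul_of_nonneg_left
        (le_abs_self (mean (Q s a) W - mean (P s a) W)) hγ
      have h3 : 6 * (l * M) * (W s - c s a - γ * mean (P s a) W) ≤
          W s - c s a - γ * mean (P s a) W := by
        nlinarith [hW.1 s a]
      have h4 : 6 * l * M * (U s - c s a - γ * mean (Q s a) U) = 0 := by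
        rw [sub_sub, ← ha]; ring
      linarith) s
  have lower := le_div_of_le_mean Q (k := 3 * η) hγ hγ1
    (F := fun t => (-1) * U t + (-(-1)) * W t + 3 * l * W t ^ 2 - 6 * l * M * U t) (fun s => by
      -- For an action optimal for `W` the gap vanishes.
      obtain ⟨a, ha⟩ := hW.2 s
      refine ⟨a, ?_⟩
      rw [hmean]
      have h1 := key s a
      have h2 := mul_le_mul_of_nonneg_left
        (neg_abs_le (mean (Q s a) W - mean (P s a) W)) hγ
      have h3 := hU.1 s a
      have h4 := mul_le_mul_of_nonneg_left h3 hlM0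
      have h5 : 6 * l * M * (W s - c s a - γ * mean (P s a) W) = 0 := by
        rw [sub_sub, ← ha]; ring
      linarith) s
  rw [abs_le]
  constructor <;> linarith [hlU s, hlW s]

end Sensitivity

/-! ### Concentration of the empirical means -/

section Concentration

/-- Subtracting `x ^ 2` leaves a linear bound, so a centred variable compensated by its own square
has exponential moment at most 1. This is why the Bernstein bound below involves the empirical
second moment. -/
theorem exp_sub_sq_le {x : ℝ} (h1 : -(1 / 4) ≤ x) (h2 : x ≤ 1 / 4) :
    Real.exp (x - x ^ 2) ≤ 1 + x := by
  rcases le_total 0 x with hx | hx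
  · have h := Real.abs_exp_sub_one_sub_id_le (x := x - x ^ 2)
      (abs_le.2 ⟨by nlinarith, by nlinarith⟩)
    have h3 := (abs_le.1 h).2
    have h4 : (1 - x) ^ 2 ≤ 1 := by nlinarith
    nlinarith [mul_le_mul_of_nonneg_left h4 (sq_nonneg x)]
  · have h := Real.quadratic_le_exp_of_nonneg (x := x ^ 2 - x) (by nlinarith)
    have h3 : 1 ≤ (1 + x) * Real.exp (x ^ 2 - x) := by
      refine le_trans ?_ (mul_le_mul_of_nonneg_left h (by linarith))
      have h4 : 0 ≤ (1 + x) * (1 - x) ^ 2 + 2 * x := by nlinarith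
      nlinarith [mul_nonneg (sq_nonneg x) h4]
    rw [show x - x ^ 2 = -(x ^ 2 - x) by ring, Real.exp_neg]
    rwa [inv_le_iff_one_le_mul₀ (Real.exp_pos _)]

theorem mean_exp_sub_sq_le_one {S : Type*} [Fintype S] (μ : PMF S) {X : S → ℝ} (hX : mean μ X = 0)
    (h : ∀ s, |X s| ≤ 1 / 4) : mean μ (fun s => Real.exp (X s - X s ^ 2)) ≤ 1 := by
  have h1 : ∀ s, Real.exp (X s - X s ^ 2) ≤ 1 + X s := fun s =>
    exp_sub_sq_le (abs_le.1 (h s)).1 (abs_le.1 (h s)).2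
  refine (mean_mono μ h1).trans_eq ?_
  rw [mean_add, mean_const, hX, add_zero]

/-- The samples `k, …, k + N - 1` of every state-action pair. -/
def block {S A : Type*} (ω : ℕ × S × A → S) (k N : ℕ) : Fin N → S → A → S :=
  fun j s a => ω (k + (j : ℕ), s, a)

theorem mean_empirical {S A : Type*} [Fintype S] [Nonempty S] {N : ℕ} (hN : N ≠ 0)
    (d : Fin N → S → A → S) (s : S) (a : A) (f : S → ℝ) :
    mean (empirical N d s a) f = (∑ j, f (d j s a)) / N := by
  cases N with
  | zero => exact absurd rfl hN
  | succ N =>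
  have h : empirical (N + 1) d s a =
      (PMF.uniformOfFintype (Fin (N + 1))).bind fun j => PMF.pure (d j s a) := rfl
  rw [h, mean_bind]
  simp only [mean_pure]
  rw [mean, Finset.sum_div]
  refine Finset.sum_congr rfl fun j _ => ?_
  rw [PMF.uniformOfFintype_apply, Fintype.card_fin, ENNReal.toReal_inv, ENNReal.toReal_natCast]
  ring

variable {S A : Type*} [Fintype S] [MeasurableSpace S] [DiscreteMeasurableSpace S]

instance isProbabilityMeasure_sampleLaw (P : S → A → PMF S) :
    IsProbabilityMeasure (sampleLaw P) := by
  unfold sampleLaw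
  infer_instance

-- Chernoff's bound with parameter 1: the samples are distinct coordinates of a product measure, so
-- the exponential moments multiply.
open ProbabilityTheory in
theorem sampleLaw_sum_ge_le (P : S → A → PMF S) (s : S) (a : A) (k N : ℕ) {f : S → ℝ}
    (hf : mean (P s a) (fun t => Real.exp (f t)) ≤ 1) (L : ℝ) :
    sampleLaw P {ω | L ≤ ∑ j, f (block ω k N j s a)} ≤ ENNReal.ofReal (Real.exp (-L)) := by
  have hfm : Measurable f := measurable_of_finite f
  let e : Fin N → ℕ × S × A := fun j => (k + (j : ℕ), s, a)
  have he : Function.Injective e := fun i j hij => by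
    have := congrArg Prod.fst hij
    exact Fin.ext (Nat.add_left_cancel this)
  let X : Fin N → (ℕ × S × A → S) → ℝ := fun j ω => f (ω (e j))
  have hXm : ∀ j, Measurable (X j) := fun j => hfm.comp (measurable_pi_apply _)
  have hind : iIndepFun X (sampleLaw P) :=
    iIndepFun.precomp he (iIndepFun_infinitePi (P := fun i : ℕ × S × A => (P i.2.1 i.2.2).toMeasure)
      (X := fun _ => f) fun _ => hfm)
  have hmgf : ∀ j, mgf (X j) (sampleLaw P) 1 ≤ 1 := fun j => by
    have h1 : mgf (X j) (sampleLaw P) 1 = ∫ t, Real.exp (f t) ∂(P s a).toMeasure := by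
      have hm := measurePreserving_eval_infinitePi
        (fun i : ℕ × S × A => (P i.2.1 i.2.2).toMeasure) (e j)
      rw [← hm.map_eq, integral_map hm.measurable.aemeasurable
        (measurable_of_finite _).aestronglyMeasurable]
      simp only [mgf, one_mul]
      rfl
    rw [h1, PMF.integral_eq_sum]
    exact hf
  have hmgfsum : mgf (∑ j, X j) (sampleLaw P) 1 ≤ 1 := by
    rw [hind.mgf_sum hXm]
    exact Finset.prod_le_one (fun j _ => mgf_nonneg) fun j _ => hmgf j
  obtain ⟨C, hC⟩ := (Set.finite_range f).bddAbove
  have hle : ∀ ω, (∑ j, X j) ω ≤ N * C := fun ω => by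
    rw [Finset.sum_apply]
    refine (Finset.sum_le_sum fun j _ => hC ⟨ω (e j), rfl⟩).trans_eq ?_
    simp
  have hXsum : Measurable (∑ j, X j) := by fun_prop
  have hint : Integrable (fun ω => Real.exp (1 * (∑ j, X j) ω)) (sampleLaw P) := by
    refine Integrable.of_bound (C := Real.exp (N * C)) ?_ (ae_of_all _ fun ω => ?_)
    · exact (Real.measurable_exp.comp (hXsum.const_mul 1)).aestronglyMeasurable
    · rw [Real.norm_eq_abs, Real.abs_exp, one_mul]
      exact Real.exp_le_exp.2 (hle ω)
  have h := measure_ge_le_exp_mul_mgf L zero_le_one hint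
  have hset : {ω | L ≤ ∑ j, f (block ω k N j s a)} = {ω | L ≤ (∑ j, X j) ω} := by
    ext ω
    simp only [Set.mem_ofPred_eq, Finset.sum_apply]
    rfl
  rw [hset, ← ofReal_measureReal]
  refine ENNReal.ofReal_le_ofReal (h.trans ?_)
  rw [neg_one_mul]
  exact mul_le_of_le_one_right (Real.exp_pos _).le hmgfsum

/-- An empirical Bernstein inequality, with the weight `l` of the empirical second moment fixed in
advance. -/
theorem sampleLaw_deviation_le [Nonempty S] (P : S → A → PMF S) (s : S) (a : A) (k : ℕ) {N : ℕ}
    (hN : N ≠ 0) {W : S → ℝ} {l M : ℝ} (hW0 : ∀ t, 0 ≤ W t) (hWM : ∀ t, W t ≤ M) (hl : 0 < l)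
    (hlM : l * M ≤ 1 / 4) (L : ℝ) :
    sampleLaw P {ω | ¬ |mean (empirical N (block ω k N) s a) W - mean (P s a) W| ≤
      l * mean (empirical N (block ω k N) s a) (fun t => (W t - mean (P s a) W) ^ 2) +
        L / (l * N)} ≤ ENNReal.ofReal (2 * Real.exp (-L)) := by
  set p := mean (P s a) W with hp
  have hp0 : 0 ≤ p := mean_nonneg _ hW0
  have hpM : p ≤ M := mean_le _ hWM
  have hN0 : (0 : ℝ) < N := by exact_mod_cast Nat.pos_of_ne_zero hN
  -- The two signs `x = ±l` give the two tails; dividing by `l * N` yields the stated deviation.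
  have hone : ∀ x : ℝ, |x| = l → sampleLaw P {ω | L ≤ ∑ j,
      (fun t => x * (W t - p) - (x * (W t - p)) ^ 2) (block ω k N j s a)} ≤
        ENNReal.ofReal (Real.exp (-L)) := fun x hx => by
    refine sampleLaw_sum_ge_le P s a k N (mean_exp_sub_sq_le_one _ (X := fun t => x * (W t - p)) ?_
      fun t => ?_) L
    · rw [mean_const_mul, mean_sub, mean_const, ← hp, sub_self, mul_zero]
    · rw [abs_mul, hx]
      refine (mul_le_mul_of_nonneg_left ?_ hl.le).trans hlM
      exact abs_le.2 ⟨by linarith [hW0 t], by linarith [hWM t]⟩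
  have hsum : ∀ (x : ℝ) ω, |x| = l → ∑ j, (fun t => x * (W t - p) - (x * (W t - p)) ^ 2)
      (block ω k N j s a) = N * (x * (mean (empirical N (block ω k N) s a) W - p) -
        l ^ 2 * mean (empirical N (block ω k N) s a) (fun t => (W t - p) ^ 2)) := fun x ω hx => by
    have h1 := mean_empirical hN (block ω k N) s a
      (fun t => x * (W t - p) - x ^ 2 * (W t - p) ^ 2)
    rw [mean_sub, mean_const_mul, mean_const_mul, mean_sub, mean_const, eq_div_iff hN0.ne'] at h1
    rw [← hx, sq_abs, mul_comm, h1]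
    simp only [mul_pow]
  have hsub : {ω | ¬ |mean (empirical N (block ω k N) s a) W - p| ≤
      l * mean (empirical N (block ω k N) s a) (fun t => (W t - p) ^ 2) + L / (l * N)} ⊆
      {ω | L ≤ ∑ j, (fun t => l * (W t - p) - (l * (W t - p)) ^ 2) (block ω k N j s a)} ∪
      {ω | L ≤ ∑ j, (fun t => (-l) * (W t - p) - ((-l) * (W t - p)) ^ 2)
        (block ω k N j s a)} := fun ω hω => by
    simp only [Set.mem_union, Set.mem_ofPred_eq]
    rw [hsum l ω (abs_of_pos hl), hsum (-l) ω (by rw [abs_neg, abs_of_pos hl])]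
    by_contra! hcon
    refine hω ?_
    have e : L / (l * N) * (l * N) = L := div_mul_cancel₀ _ (by positivity)
    have hlN : 0 < l * N := by positivity
    rw [abs_le']
    constructor <;> refine le_of_mul_le_mul_right ?_ hlN <;> rw [add_mul, e] <;>
      nlinarith [hcon.1, hcon.2]
  refine (measure_mono hsub).trans ((measure_union_le _ _).trans ?_)
  rw [two_mul, ENNReal.ofReal_add (Real.exp_pos _).le (Real.exp_pos _).le]
  exact add_le_add (hone l (abs_of_pos hl)) (hone (-l) (by rw [abs_neg, abs_of_pos hl]))

end Concentration

/-! ### The accuracy of the empirical optimal value -/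

section Accuracy

variable {S A : Type*}

theorem le_cMax [Finite S] [Finite A] (c : S → A → ℝ) (s : S) (a : A) : c s a ≤ cMax c :=
  le_ciSup (f := fun p : S × A => c p.1 p.2) (Set.finite_range _).bddAbove (s, a)

theorem cMax_nonneg {c : S → A → ℝ} (hc : ∀ s a, 0 ≤ c s a) : 0 ≤ cMax c :=
  Real.iSup_nonneg fun p => hc p.1 p.2

theorem cMax_le_one [Nonempty S] [Nonempty A] {c : S → A → ℝ} (hc : ∀ s a, c s a ≤ 1) :
    cMax c ≤ 1 :=
  ciSup_le fun p => hc p.1 p.2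

theorem sampleLaw_optimalValue_le [Fintype S] [Nonempty S] [Fintype A] [Nonempty A]
    [MeasurableSpace S] [DiscreteMeasurableSpace S]
    (P : S → A → PMF S) (ρ : PMF S) {γ : ℝ} {c : S → A → ℝ} (hγ : 0 ≤ γ) (hγ1 : γ < 1)
    (hc : ∀ s a, 0 ≤ c s a ∧ c s a ≤ 1) {ε L : ℝ} (hε : 0 < ε) (hL : 0 < L) (k N : ℕ)
    (hN : ε < cMax c / (1 - γ) → 144 * L * cMax c ≤ (1 - γ) ^ 3 * ε ^ 2 * N) :
    sampleLaw P {ω | ¬ |optimalValue (empirical N (block ω k N)) ρ γ c -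
      optimalValue P ρ γ c| ≤ ε} ≤
      ENNReal.ofReal (2 * ((Fintype.card S : ℝ) * (Fintype.card A : ℝ)) *
        Real.exp (-(2 * L))) := by
  have hg : 0 < 1 - γ := by linarith
  have hc0 : ∀ s a, 0 ≤ c s a := fun s a => (hc s a).1
  set C := cMax c with hC
  set M := C / (1 - γ) with hM
  obtain ⟨W, hW⟩ := exists_isBellman P c hγ hγ1
  have hW0 := hW.nonneg hγ hγ1 hc0
  have hWM : ∀ s, W s ≤ M := hW.le hγ hγ1 (le_cMax c)
  -- Both values lie in `[0, M]`, so for `ε ≥ M` no samples are needed. Otherwise `ε < M` gives `l *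
  -- M ≤ 1 / 12` below.
  rcases le_or_gt M ε with hMε | hMε
  · have hempty : {ω | ¬ |optimalValue (empirical N (block ω k N)) ρ γ c -
        optimalValue P ρ γ c| ≤ ε} = ∅ := by
      refine Set.eq_empty_of_forall_notMem fun ω hω => hω ?_
      obtain ⟨U, hU⟩ := exists_isBellman (empirical N (block ω k N)) c hγ hγ1
      rw [hU.optimalValue_eq ρ hγ hγ1 hc0, hW.optimalValue_eq ρ hγ hγ1 hc0]
      have hU0 := hU.nonneg hγ hγ1 hc0
      have hUM : ∀ s, U s ≤ M := hU.le hγ hγ1 (le_cMax c)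
      refine (abs_mean_sub_le ρ fun s => ?_).trans hMε
      exact abs_le.2 ⟨by linarith [hU0 s, hWM s], by linarith [hUM s, hW0 s]⟩
    rw [hempty, measure_empty]
    exact zero_le
  · have hM0 : 0 < M := hε.trans hMε
    have hC0 : 0 < C := by
      have : C = M * (1 - γ) := (div_mul_cancel₀ _ hg.ne').symm
      rw [this]
      positivity
    have hC1 : C ≤ 1 := cMax_le_one fun s a => (hc s a).2
    have hN1 := hN hMε
    have hN0 : N ≠ 0 := by
      rintro rfl
      have : 0 < 144 * L * C := by positivity
      rw [Nat.cast_zero, mul_zero] at hN1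
      linarith
    have hNpos : (0 : ℝ) < N := by exact_mod_cast Nat.pos_of_ne_zero hN0
    -- Chosen so that `6 * l * M ^ 2 = ε / 2`. The other half of `ε` fixes the constant 144 in `hN`,
    -- after `C ^ 2 ≤ C`.
    set l := ε / (12 * M ^ 2) with hl
    have hl0 : 0 < l := by positivity
    have hlM2 : l * M ^ 2 = ε / 12 := by rw [hl]; field_simp
    have hlM : l * M ≤ 1 / 12 := by
      refine le_of_mul_le_mul_right ?_ hM0
      nlinarith
    have hη : 3 * (2 * L / (l * N)) / (1 - γ) ≤ ε / 2 := by
      have e : 3 * (2 * L / (l * N)) / (1 - γ) = 72 * L * C ^ 2 / ((1 - γ) ^ 3 * ε * N) := by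
        rw [hl, hM]; field_simp; ring
      rw [e, div_le_iff₀ (by positivity)]
      have h1 : L * C ^ 2 ≤ L * C := by
        refine mul_le_mul_of_nonneg_left ?_ hL.le
        nlinarith
      nlinarith
    have hsub : {ω | ¬ |optimalValue (empirical N (block ω k N)) ρ γ c -
        optimalValue P ρ γ c| ≤ ε} ⊆ ⋃ p : S × A,
        {ω | ¬ |mean (empirical N (block ω k N) p.1 p.2) W - mean (P p.1 p.2) W| ≤
          l * mean (empirical N (block ω k N) p.1 p.2)
            (fun t => (W t - mean (P p.1 p.2) W) ^ 2) + 2 * L / (l * N)} := fun ω hω => by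
      by_contra hcon
      refine hω ?_
      obtain ⟨U, hU⟩ := exists_isBellman (empirical N (block ω k N)) c hγ hγ1
      rw [hU.optimalValue_eq ρ hγ hγ1 hc0, hW.optimalValue_eq ρ hγ hγ1 hc0]
      refine abs_mean_sub_le ρ fun s => ?_
      refine (hW.abs_sub_le (η := 2 * L / (l * N)) hU hγ hγ1 hc0 hWM (hU.le hγ hγ1 (le_cMax c))
        hl0.le hlM (by positivity)
        (fun s a => not_not.1 fun h => hcon (Set.mem_iUnion.2 ⟨(s, a), h⟩)) s).trans ?_
      rw [mul_assoc, hlM2]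
      linarith
    refine (measure_mono hsub).trans ((measure_iUnion_fintype_le _ _).trans ?_)
    refine (Finset.sum_le_sum fun p _ => sampleLaw_deviation_le P p.1 p.2 k hN0 hW0 hWM hl0
      (hlM.trans (by norm_num)) (2 * L)).trans_eq ?_
    rw [Finset.sum_const, nsmul_eq_mul, Finset.card_univ, Fintype.card_prod,
      ← ENNReal.ofReal_natCast, ← ENNReal.ofReal_mul (Nat.cast_nonneg _)]
    congr 1
    push_cast
    ring

end Accuracy

/-! ### The runs of the doubling procedure -/

section Runs

theorem accuracy_pos {γ : ℝ} (hγ1 : γ < 1) (i : ℕ) : 0 < accuracy γ i := by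
  have : 0 < 1 - γ := by linarith
  unfold accuracy
  positivity

theorem one_sub_mul_accuracy {γ : ℝ} (hγ1 : γ < 1) (i : ℕ) :
    (1 - γ) * accuracy γ i = (1 / 2) ^ i :=
  mul_div_cancel₀ _ (by linarith)

theorem accuracy_succ (γ : ℝ) (i : ℕ) : accuracy γ (i + 1) = accuracy γ i / 2 := by
  unfold accuracy
  ring

/-- The logarithmic factor in the sample size of run `i`. -/
noncomputable def runLog (S A : Type*) [Fintype S] [Fintype A] (γ δ : ℝ) (i : ℕ) : ℝ :=
  Real.log (2 * ((Fintype.card S : ℝ) * (Fintype.card A : ℝ)) * ((i : ℝ) + 1) ^ 2 /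
    ((1 - γ) * accuracy γ i * δ))

variable {S A : Type*} [Fintype S] [Nonempty S] [Fintype A] [Nonempty A]

variable (S A) in
theorem one_le_card_mul_card : (1 : ℝ) ≤ (Fintype.card S : ℝ) * (Fintype.card A : ℝ) := by
  exact_mod_cast Nat.mul_pos (Fintype.card_pos (α := S)) (Fintype.card_pos (α := A))

variable (S A) in
theorem two_le_div_pow {δ : ℝ} (hδ : 0 < δ) (hδ1 : δ < 1) (i : ℕ) :
    2 ≤ 2 * ((Fintype.card S : ℝ) * (Fintype.card A : ℝ)) / ((1 / 2) ^ i * δ) := by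
  have h := one_le_card_mul_card S A
  have h2 : ((1 : ℝ) / 2) ^ i ≤ 1 := pow_le_one₀ (by norm_num) (by norm_num)
  rw [le_div_iff₀ (by positivity)]
  nlinarith [mul_le_one₀ h2 hδ.le hδ1.le]

variable (S A) in
theorem log_le_runLog {γ δ : ℝ} (hγ1 : γ < 1) (hδ : 0 < δ) (hδ1 : δ < 1) (i : ℕ) :
    Real.log (2 * ((Fintype.card S : ℝ) * (Fintype.card A : ℝ)) / ((1 / 2) ^ i * δ)) ≤
      runLog S A γ δ i := by
  have h := one_le_card_mul_card S A
  have h1 := two_le_div_pow S A hδ hδ1 i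
  rw [runLog, one_sub_mul_accuracy hγ1]
  refine Real.log_le_log (by linarith) ?_
  refine div_le_div_of_nonneg_right ?_ (by positivity)
  refine le_mul_of_one_le_right (by positivity) ?_
  have : (0 : ℝ) ≤ i := Nat.cast_nonneg i
  nlinarith

variable (S A) in
theorem half_le_runLog {γ δ : ℝ} (hγ1 : γ < 1) (hδ : 0 < δ) (hδ1 : δ < 1) (i : ℕ) :
    1 / 2 ≤ runLog S A γ δ i := by
  have h := Real.log_le_log two_pos (two_le_div_pow S A hδ hδ1 i)
  linarith [log_le_runLog S A hγ1 hδ hδ1 i, Real.log_two_gt_d9]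

-- The exponent `2 * runLog` supplies `y⁻¹` twice: one factor cancels the number of union-bound
-- events, the other is at most `1 / 2`. The factor `(i+1)²` in the logarithm is not needed here.
variable (S A) in
theorem card_mul_exp_runLog_le {γ δ : ℝ} (hγ1 : γ < 1) (hδ : 0 < δ) (hδ1 : δ < 1) (i : ℕ) :
    2 * ((Fintype.card S : ℝ) * (Fintype.card A : ℝ)) * Real.exp (-(2 * runLog S A γ δ i)) ≤
      δ / 2 / 2 ^ i := by
  have h := one_le_card_mul_card S A
  have h1 := two_le_div_pow S A hδ hδ1 i
  set n := 2 * ((Fintype.card S : ℝ) * (Fintype.card A : ℝ)) with hn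
  set y := n / ((1 / 2) ^ i * δ) with hy
  have hy0 : 0 < y := by linarith
  have h2 : Real.exp (-(2 * runLog S A γ δ i)) ≤ (y * y)⁻¹ := by
    rw [← Real.exp_log hy0, ← Real.exp_add, ← Real.exp_neg]
    exact Real.exp_le_exp.2 (by linarith [log_le_runLog S A hγ1 hδ hδ1 i])
  have hn0 : 0 < n := by linarith
  have h3 : n * (y * y)⁻¹ = (1 / 2) ^ i * δ * y⁻¹ := by
    have : n = y * ((1 / 2) ^ i * δ) := (div_mul_cancel₀ _ (by positivity)).symm
    rw [mul_inv]
    nth_rewrite 1 [this]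
    field_simp
  calc n * Real.exp (-(2 * runLog S A γ δ i)) ≤ n * (y * y)⁻¹ :=
        mul_le_mul_of_nonneg_left h2 hn0.le
    _ = (1 / 2) ^ i * δ * y⁻¹ := h3
    _ ≤ (1 / 2) ^ i * δ * 2⁻¹ := by
        refine mul_le_mul_of_nonneg_left ?_ (by positivity)
        exact inv_anti₀ two_pos h1
    _ = δ / 2 / 2 ^ i := by
        rw [one_div, inv_pow]
        ring

omit [Nonempty S] [Nonempty A] in
theorem runSize_eq (κ γ : ℝ) (c : S → A → ℝ) (δ : ℝ) (i : ℕ) : runSize κ γ c δ i =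
    ⌊κ * cMax c * runLog S A γ δ i / ((1 - γ) ^ 3 * accuracy γ i ^ 2)⌋₊ := rfl

theorem le_runSize {γ δ : ℝ} {c : S → A → ℝ} (hγ : 0 ≤ γ) (hγ1 : γ < 1)
    (hc : ∀ s a, 0 ≤ c s a ∧ c s a ≤ 1) (hδ : 0 < δ) (hδ1 : δ < 1) (i : ℕ)
    (h : accuracy γ i < cMax c / (1 - γ)) :
    144 * runLog S A γ δ i * cMax c ≤
      (1 - γ) ^ 3 * accuracy γ i ^ 2 * runSize 288 γ c δ i := by
  have hg : 0 < 1 - γ := by linarith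
  have hL := half_le_runLog S A hγ1 hδ hδ1 i
  have hε := accuracy_pos hγ1 i
  have hC1 : cMax c ≤ 1 := cMax_le_one fun s a => (hc s a).2
  rw [runSize_eq]
  set L := runLog S A γ δ i
  set ε := accuracy γ i
  set C := cMax c
  rw [lt_div_iff₀ hg] at h
  have hC0 : 0 < C := (mul_pos hε hg).trans h
  set D := (1 - γ) ^ 3 * ε ^ 2 with hD
  have hD0 : 0 < D := by positivity
  have hDC : D ≤ C := by
    have h1 : (ε * (1 - γ)) ^ 2 ≤ C ^ 2 := pow_le_pow_left₀ (by positivity) h.le 2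
    have h2 : C ^ 2 ≤ C := by nlinarith
    have h3 : D = (1 - γ) * (ε * (1 - γ)) ^ 2 := by rw [hD]; ring
    rw [h3]
    nlinarith [sq_nonneg (ε * (1 - γ))]
  -- Rounding down a number at least 1 loses at most a factor 2, whence 288 = 2 · 144.
  have hx : 1 ≤ 288 * C * L / D := by
    rw [le_div_iff₀ hD0]
    nlinarith
  have h1 : 288 * C * L / D / 2 ≤ ⌊288 * C * L / D⌋₊ := by
    have h2 := Nat.lt_floor_add_one (288 * C * L / D)
    have h3 : (1 : ℝ) ≤ ⌊288 * C * L / D⌋₊ := by exact_mod_cast Nat.floor_pos.2 hx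
    linarith
  have h2 := mul_le_mul_of_nonneg_left h1 hD0.le
  have h3 : D * (288 * C * L / D / 2) = 144 * L * C := by field_simp; ring
  linarith

/-- The empirical optimal value of run `i` on the sample table `ω`. -/
noncomputable def tableValue (κ γ : ℝ) (c : S → A → ℝ) (ρ : PMF S) (δ : ℝ) (ω : ℕ × S × A → S)
    (i : ℕ) : ℝ :=
  optimalValue (empirical (runSize κ γ c δ i)
    (block ω (runStart κ γ c δ i) (runSize κ γ c δ i))) ρ γ c

theorem sampleLaw_exists_inaccurate_le [MeasurableSpace S] [DiscreteMeasurableSpace S]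
    (P : S → A → PMF S) (ρ : PMF S) {γ δ : ℝ} {c : S → A → ℝ} (hγ : 0 ≤ γ) (hγ1 : γ < 1)
    (hc : ∀ s a, 0 ≤ c s a ∧ c s a ≤ 1) (hδ : 0 < δ) (hδ1 : δ < 1) :
    sampleLaw P {ω | ∃ i, ¬ |tableValue 288 γ c ρ δ ω i - optimalValue P ρ γ c| ≤
      accuracy γ i} ≤ ENNReal.ofReal δ := by
  have hset : {ω | ∃ i, ¬ |tableValue 288 γ c ρ δ ω i - optimalValue P ρ γ c| ≤ accuracy γ i} =
      ⋃ i, {ω | ¬ |tableValue 288 γ c ρ δ ω i - optimalValue P ρ γ c| ≤ accuracy γ i} := by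
    ext ω
    simp only [Set.mem_ofPred_eq, Set.mem_iUnion]
  have hsum : ENNReal.ofReal δ = ∑' i : ℕ, ENNReal.ofReal (δ / 2 / 2 ^ i) := by
    rw [← ENNReal.ofReal_tsum_of_nonneg (fun i => by positivity) (summable_geometric_two' δ),
      tsum_geometric_two']
  rw [hset, hsum]
  refine (measure_iUnion_le _).trans (ENNReal.tsum_le_tsum fun i => ?_)
  refine (sampleLaw_optimalValue_le P ρ hγ hγ1 hc (accuracy_pos hγ1 i)
    (half_pos one_pos |>.trans_le (half_le_runLog S A hγ1 hδ hδ1 i))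
    (runStart 288 γ c δ i) (runSize 288 γ c δ i)
    (le_runSize hγ hγ1 hc hδ hδ1 i)).trans ?_
  exact ENNReal.ofReal_le_ofReal (card_mul_exp_runLog_le S A hγ1 hδ hδ1 i)

omit [Nonempty S] [Nonempty A] in
theorem runStart_mono (κ γ : ℝ) (c : S → A → ℝ) (δ : ℝ) : Monotone (runStart κ γ c δ) :=
  fun _ _ h => Finset.sum_le_sum_of_subset (Finset.range_mono h)

omit [Nonempty A] in
theorem runStops_history_iff (κ γ : ℝ) (c : S → A → ℝ) (b : ℝ) (ρ : PMF S) (δ : ℝ)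
    (ω : ℕ × S × A → S) (n i : ℕ) : RunStops κ γ c b ρ δ n (history ω n) i ↔
      runStart κ γ c δ (i + 1) = n ∧ 9 * accuracy γ i ≤ |tableValue κ γ c ρ δ ω i - b| := by
  constructor
  · rintro ⟨h, h'⟩
    exact ⟨h, h'⟩
  · rintro ⟨h, h'⟩
    exact ⟨h, h'⟩

-- Runs of size 0 share their sample count with the preceding run, so several may be tested at the
-- same `n`; `Nat.find` picks the earliest success.
omit [Nonempty A] in
theorem haltsWith_doublingAlgorithm {κ γ : ℝ} {c : S → A → ℝ} {b : ℝ} {ρ : PMF S} {δ : ℝ}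
    {ω : ℕ × S × A → S} {i : ℕ} (hi : 9 * accuracy γ i ≤ |tableValue κ γ c ρ δ ω i - b|)
    (hlt : ∀ j < i, ¬ 9 * accuracy γ j ≤ |tableValue κ γ c ρ δ ω j - b|) :
    HaltsWith (doublingAlgorithm κ γ c b ρ δ) ω (runStart κ γ c δ (i + 1))
      (tableValue κ γ c ρ δ ω i - b) := by
  classical
  refine ⟨fun m hm => dif_neg ?_, ?_⟩
  · rintro ⟨j, hj⟩
    rw [runStops_history_iff] at hj
    refine hlt j ?_ hj.2
    by_contra! hij
    have := runStart_mono κ γ c δ (Nat.add_le_add_right hij 1)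
    omega
  · have h : ∃ j, RunStops κ γ c b ρ δ (runStart κ γ c δ (i + 1))
        (history ω (runStart κ γ c δ (i + 1))) j :=
      ⟨i, (runStops_history_iff κ γ c b ρ δ ω _ i).2 ⟨rfl, hi⟩⟩
    have hfind : Nat.find h = i := by
      refine le_antisymm (Nat.find_min' h ((runStops_history_iff κ γ c b ρ δ ω _ i).2 ⟨rfl, hi⟩))
        (le_of_not_gt fun hlt' => hlt _ hlt' ?_)
      exact ((runStops_history_iff κ γ c b ρ δ ω _ _).1 (Nat.find_spec h)).2
    refine (dif_pos h).trans (congrArg some ?_)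
    change tableValue κ γ c ρ δ ω (Nat.find _) - b = _
    exact congrArg (fun j => tableValue κ γ c ρ δ ω j - b) hfind

theorem exists_first_success {γ ζ : ℝ} (hγ1 : γ < 1) (hζ : 0 < ζ) (hζ1 : ζ ≤ 1 / (1 - γ))
    {x : ℕ → ℝ} (hx : ∀ i, |x i - ζ| ≤ accuracy γ i) :
    ∃ i, 9 * accuracy γ i ≤ |x i| ∧ (∀ j < i, ¬ 9 * accuracy γ j ≤ |x j|) ∧
      ζ ≤ 20 * accuracy γ i ∧ |x i - ζ| ≤ 2 / 10 * ζ := by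
  classical
  have hg : 0 < 1 - γ := by linarith
  have hlarge : ∀ i, 10 * accuracy γ i ≤ ζ → 9 * accuracy γ i ≤ |x i| := fun i hi => by
    have := (abs_le.1 (hx i)).1
    linarith [le_abs_self (x i)]
  have hex : ∃ i, 9 * accuracy γ i ≤ |x i| := by
    obtain ⟨i, hi⟩ := exists_pow_lt_of_lt_one (show 0 < ζ * (1 - γ) / 10 by positivity)
      (show (1 / 2 : ℝ) < 1 by norm_num)
    refine ⟨i, hlarge i ?_⟩
    rw [accuracy, ← mul_div_assoc, div_le_iff₀ hg]
    linarith
  refine ⟨Nat.find hex, Nat.find_spec hex, fun j hj => Nat.find_min hex hj, ?_, ?_⟩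
  · rcases Nat.eq_zero_or_pos (Nat.find hex) with h0 | h0
    · rw [h0]
      have : accuracy γ 0 = 1 / (1 - γ) := by rw [accuracy, pow_zero]
      have := accuracy_pos hγ1 0
      linarith
    · have h1 : Nat.find hex - 1 < Nat.find hex := by omega
      have h2 := Nat.find_min hex h1
      have h3 : ζ < 10 * accuracy γ (Nat.find hex - 1) := by
        by_contra! h4
        exact h2 (hlarge _ h4)
      have h4 := accuracy_succ γ (Nat.find hex - 1)
      rw [Nat.sub_add_cancel h0] at h4
      linarith
  · have h1 := Nat.find_spec hex
    have h2 := hx (Nat.find hex)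
    have h3 := accuracy_pos hγ1 (Nat.find hex)
    obtain ⟨h4, h5⟩ := abs_le.1 h2
    -- Success on the positive side gives `ζ ≥ 8 ζ_i`; the negative side would contradict `ζ > 0`.
    rcases le_abs.1 h1 with h6 | h6
    · linarith
    · linarith

/-! ### The total number of samples. -/

theorem runLog_le {γ δ : ℝ} (hγ1 : γ < 1) (hδ : 0 < δ) (hδ1 : δ < 1)
    (hcard : 2 ≤ (Fintype.card S : ℝ) * (Fintype.card A : ℝ)) {ζ : ℝ} (hζ : 0 < ζ)
    (hζ1 : ζ ≤ 1 / (1 - γ)) {i : ℕ} (hi : ζ ≤ 20 * accuracy γ i) :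
    runLog S A γ δ i ≤
      17 * Real.log ((Fintype.card S : ℝ) * (Fintype.card A : ℝ) / ((1 - γ) * δ * ζ)) := by
  have hg : 0 < 1 - γ := by linarith
  rw [runLog, one_sub_mul_accuracy hγ1]
  set n := (Fintype.card S : ℝ) * (Fintype.card A : ℝ)
  set y := (1 - γ) * ζ with hy
  have hy0 : 0 < y := by positivity
  have hy1 : y ≤ 1 := by
    rw [le_div_iff₀ hg] at hζ1
    linarith
  set x := n / ((1 - γ) * δ * ζ) with hx
  have hx2 : 2 ≤ x := by
    rw [hx, le_div_iff₀ (by positivity)]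
    have : (1 - γ) * δ * ζ = δ * y := by rw [hy]; ring
    rw [this]
    nlinarith [mul_le_one₀ hδ1.le hy0.le hy1]
  have hpow : y ≤ 20 * (1 / 2) ^ i := by
    rw [← one_sub_mul_accuracy hγ1 i]
    nlinarith
  have h2i : (2 : ℝ) ^ i * (1 / 2) ^ i = 1 := by
    rw [← mul_pow]; norm_num
  have hi2 : ((i : ℝ) + 1) ≤ 2 ^ i := by exact_mod_cast Nat.lt_two_pow_self
  have h2y : (2 : ℝ) ^ i ≤ 20 / y := by
    rw [le_div_iff₀ hy0]
    calc (2 : ℝ) ^ i * y ≤ 2 ^ i * (20 * (1 / 2) ^ i) :=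
          mul_le_mul_of_nonneg_left hpow (by positivity)
      _ = 20 * (2 ^ i * (1 / 2) ^ i) := by ring
      _ = 20 := by rw [h2i, mul_one]
  -- Since `i + 1 ≤ 2 ^ i ≤ 20 / y`, the argument is at most `2 · 20³ x³`, and `16000 ≤ 2¹⁴ ≤ x¹⁴`.
  -- The bound `x ≥ 2` is where at least two state-action pairs are required.
  have harg : 2 * n * ((i : ℝ) + 1) ^ 2 / ((1 / 2) ^ i * δ) ≤ x ^ 17 := by
    have h1 : 2 * n * ((i : ℝ) + 1) ^ 2 / ((1 / 2) ^ i * δ) =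
        2 * (n / δ) * (((i : ℝ) + 1) ^ 2 * 2 ^ i) := by
      rw [div_eq_iff (by positivity)]
      have h2 : n / δ * δ = n := div_mul_cancel₀ _ hδ.ne'
      linear_combination (-(2 * (n / δ * δ) * ((i : ℝ) + 1) ^ 2)) * h2i -
        2 * ((i : ℝ) + 1) ^ 2 * h2
    have h3 : ((i : ℝ) + 1) ^ 2 * 2 ^ i ≤ (20 / y) ^ 3 := by
      rw [pow_succ (20 / y)]
      exact mul_le_mul (pow_le_pow_left₀ (by positivity) (hi2.trans h2y) 2) h2y (by positivity)
        (by positivity)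
    have hnδ : 1 ≤ n / δ := by
      rw [le_div_iff₀ hδ]
      linarith
    have h4 : x = n / δ * (1 / y) := by rw [hx, hy]; field_simp
    have h5 : n / δ ≤ (n / δ) ^ 3 := le_self_pow₀ hnδ (by norm_num)
    have h6 : (2 : ℝ) ^ 14 ≤ x ^ 14 := pow_le_pow_left₀ (by norm_num) hx2 14
    calc _ = 2 * (n / δ) * (((i : ℝ) + 1) ^ 2 * 2 ^ i) := h1
      _ ≤ 2 * (n / δ) ^ 3 * (20 / y) ^ 3 := by gcongr
      _ = 16000 * x ^ 3 := by rw [h4]; ring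
      _ ≤ x ^ 14 * x ^ 3 := by
          refine mul_le_mul_of_nonneg_right (le_trans (by norm_num) h6) (by positivity)
      _ = x ^ 17 := by ring
  have h0 : 0 < 2 * n * ((i : ℝ) + 1) ^ 2 / ((1 / 2) ^ i * δ) := by positivity
  refine (Real.log_le_log h0 harg).trans_eq ?_
  rw [Real.log_pow]
  norm_num

theorem runLog_mono {γ δ : ℝ} (hγ1 : γ < 1) (hδ : 0 < δ) {i j : ℕ} (hij : i ≤ j) :
    runLog S A γ δ i ≤ runLog S A γ δ j := by
  have h := one_le_card_mul_card S A
  rw [runLog, runLog, one_sub_mul_accuracy hγ1, one_sub_mul_accuracy hγ1]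
  refine Real.log_le_log (by positivity) ?_
  have h1 : ((1 : ℝ) / 2) ^ j ≤ (1 / 2) ^ i :=
    pow_le_pow_of_le_one (by norm_num) (by norm_num) hij
  have h2 : (i : ℝ) ≤ j := by exact_mod_cast hij
  gcongr

theorem sum_four_pow_le (i : ℕ) : ∑ j ∈ Finset.range (i + 1), (4 : ℝ) ^ j ≤ 4 / 3 * 4 ^ i := by
  rw [geom_sum_eq (by norm_num), pow_succ]
  linarith

theorem runStart_le {γ δ : ℝ} {c : S → A → ℝ} (hγ1 : γ < 1)
    (hc : ∀ s a, 0 ≤ c s a) (hδ : 0 < δ) (hδ1 : δ < 1) (i : ℕ) :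
    (runStart 288 γ c δ (i + 1) : ℝ) ≤
      384 * (cMax c * runLog S A γ δ i / ((1 - γ) ^ 3 * accuracy γ i ^ 2)) := by
  have hg : 0 < 1 - γ := by linarith
  have hC := cMax_nonneg hc
  have hL : ∀ j, 0 ≤ runLog S A γ δ j := fun j => by
    linarith [half_le_runLog S A hγ1 hδ hδ1 j]
  have hterm : ∀ x j, x / ((1 - γ) ^ 3 * accuracy γ j ^ 2) = x / (1 - γ) * 4 ^ j := fun x j => by
    have h4 : (4 : ℝ) ^ j * ((1 / 2) ^ j) ^ 2 = 1 := by
      rw [← pow_mul, mul_comm j 2, pow_mul, ← mul_pow]; norm_num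
    have hp := accuracy_pos hγ1 j
    have h5 : (1 - γ) ^ 3 * accuracy γ j ^ 2 = (1 - γ) * ((1 / 2) ^ j) ^ 2 := by
      rw [← one_sub_mul_accuracy hγ1 j]; ring
    rw [h5, div_eq_iff (by positivity)]
    field_simp
    linear_combination (-x) * h4
  rw [runStart, Nat.cast_sum, hterm]
  calc ∑ j ∈ Finset.range (i + 1), (runSize 288 γ c δ j : ℝ)
      ≤ ∑ j ∈ Finset.range (i + 1), 288 * (cMax c * runLog S A γ δ i / (1 - γ)) * 4 ^ j := by
        refine Finset.sum_le_sum fun j hj => ?_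
        rw [runSize_eq]
        have hp := accuracy_pos hγ1 j
        refine (Nat.floor_le (by have := hL j; positivity)).trans ?_
        rw [hterm]
        have := runLog_mono (S := S) (A := A) hγ1 hδ (Nat.lt_succ_iff.1 (Finset.mem_range.1 hj))
        rw [mul_assoc 288, mul_div_assoc 288]
        gcongr
    _ ≤ 288 * (cMax c * runLog S A γ δ i / (1 - γ)) * (4 / 3 * 4 ^ i) := by
        rw [← Finset.mul_sum]
        have := hL i
        exact mul_le_mul_of_nonneg_left (sum_four_pow_le i) (by positivity)
    _ = 384 * (cMax c * runLog S A γ δ i / (1 - γ) * 4 ^ i) := by ring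

theorem runStart_le_of_le {γ δ : ℝ} {c : S → A → ℝ} (hγ1 : γ < 1)
    (hc : ∀ s a, 0 ≤ c s a) (hδ : 0 < δ) (hδ1 : δ < 1)
    (hcard : 2 ≤ (Fintype.card S : ℝ) * (Fintype.card A : ℝ)) {ζ : ℝ} (hζ : 0 < ζ)
    (hζ1 : ζ ≤ 1 / (1 - γ)) {i : ℕ} (hi : ζ ≤ 20 * accuracy γ i) :
    (runStart 288 γ c δ (i + 1) : ℝ) ≤ 2611200 * (cMax c *
      Real.log ((Fintype.card S : ℝ) * (Fintype.card A : ℝ) / ((1 - γ) * δ * ζ)) /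
        ((1 - γ) ^ 3 * ζ ^ 2)) := by
  have hg : 0 < 1 - γ := by linarith
  have hC := cMax_nonneg hc
  have hL := half_le_runLog S A hγ1 hδ hδ1 i
  have hL1 := runLog_le hγ1 hδ hδ1 hcard hζ hζ1 hi
  have hε := accuracy_pos hγ1 i
  refine (runStart_le hγ1 hc hδ hδ1 i).trans ?_
  set ℓ := Real.log ((Fintype.card S : ℝ) * (Fintype.card A : ℝ) / ((1 - γ) * δ * ζ))
  have hℓ : 0 ≤ ℓ := by linarith
  -- The constant is 2611200 = 384 · 17 · 20².
  calc 384 * (cMax c * runLog S A γ δ i / ((1 - γ) ^ 3 * accuracy γ i ^ 2))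
      ≤ 384 * (cMax c * (17 * ℓ) / ((1 - γ) ^ 3 * (ζ / 20) ^ 2)) := by
        gcongr
        linarith
    _ = 2611200 * (cMax c * ℓ / ((1 - γ) ^ 3 * ζ ^ 2)) := by field_simp; ring

end Runs

/-! ### The one-state case and the conclusion. -/

theorem subsingleton_pmf (S : Type*) [Fintype S] [Subsingleton S] : Subsingleton (PMF S) := by
  have h : ∀ (p : PMF S) s, p s = 1 := fun p s => by
    rw [← p.tsum_coe, tsum_fintype, Fintype.sum_subsingleton _ s]
  exact ⟨fun p q => PMF.ext fun s => (h p s).trans (h q s).symm⟩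

end SlaterEstimation

theorem mainTheorem6 :
    ∃ κ K : ℝ, 0 < κ ∧ 0 < K ∧
      ∀ (S A : Type*) [Fintype S] [Nonempty S] [Fintype A] [Nonempty A]
        [MeasurableSpace S] [DiscreteMeasurableSpace S]
        (γ : ℝ) (c : S → A → ℝ) (b : ℝ) (ρ : PMF S) (δ : ℝ),
        0 ≤ γ → γ < 1 → (∀ s a, 0 ≤ c s a ∧ c s a ≤ 1) → 0 < δ → δ < 1 →
        ∃ alg : SlaterEstimation.SamplingAlgorithm S A,
          (2 ≤ Fintype.card S * Fintype.card A →
            alg = SlaterEstimation.doublingAlgorithm κ γ c b ρ δ) ∧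
          ∀ P : S → A → PMF S,
            0 < SlaterEstimation.slater P ρ γ c b →
            SlaterEstimation.slater P ρ γ c b ≤ 1 / (1 - γ) →
            ENNReal.ofReal (1 - δ) ≤
              SlaterEstimation.sampleLaw P
                {ω | ∃ (n : ℕ) (z : ℝ), SlaterEstimation.HaltsWith alg ω n z ∧
                  (n : ℝ) ≤ K * (SlaterEstimation.cMax c *
                    Real.log ((Fintype.card S : ℝ) * (Fintype.card A : ℝ) /
                      ((1 - γ) * δ * SlaterEstimation.slater P ρ γ c b)) /
                    ((1 - γ) ^ 3 * SlaterEstimation.slater P ρ γ c b ^ 2)) ∧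
                  |z - SlaterEstimation.slater P ρ γ c b| ≤
                    (2 / 10) * SlaterEstimation.slater P ρ γ c b} := by
  refine ⟨288, 2611200, by norm_num, by norm_num, ?_⟩
  intro S A _ _ _ _ _ _ γ c b ρ δ hγ hγ1 hc hδ hδ1
  have hg : 0 < 1 - γ := by linarith
  have hc0 : ∀ s a, 0 ≤ c s a := fun s a => (hc s a).1
  by_cases hcard : 2 ≤ Fintype.card S * Fintype.card A
  · refine ⟨SlaterEstimation.doublingAlgorithm 288 γ c b ρ δ, fun _ => rfl, fun P hζ hζ1 => ?_⟩
    have hcard' : 2 ≤ (Fintype.card S : ℝ) * (Fintype.card A : ℝ) := by exact_mod_cast hcard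
    rw [ENNReal.ofReal_sub _ hδ.le, ENNReal.ofReal_one, tsub_le_iff_right]
    refine le_trans ?_ (add_le_add_right
      (SlaterEstimation.sampleLaw_exists_inaccurate_le P ρ hγ hγ1 hc hδ hδ1) _)
    rw [← measure_univ (μ := SlaterEstimation.sampleLaw P)]
    -- Covering the whole space by the good and bad events avoids any measurability question.
    refine (measure_mono fun ω _ => ?_).trans (measure_union_le _ _)
    by_cases hω : ∃ i, ¬ |SlaterEstimation.tableValue 288 γ c ρ δ ω i -
        SlaterEstimation.optimalValue P ρ γ c| ≤ SlaterEstimation.accuracy γ i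
    · exact Or.inr hω
    · refine Or.inl ?_
      obtain ⟨i, h1, h2, h3, h4⟩ := SlaterEstimation.exists_first_success hγ1 hζ hζ1
        (x := fun i => SlaterEstimation.tableValue 288 γ c ρ δ ω i - b) (fun i => by
          rw [SlaterEstimation.slater, sub_sub_sub_cancel_right]
          exact not_not.1 fun h => hω ⟨i, h⟩)
      exact ⟨_, _, SlaterEstimation.haltsWith_doublingAlgorithm h1 h2,
        SlaterEstimation.runStart_le_of_le hγ1 hc0 hδ hδ1 hcard' hζ hζ1 h3, h4⟩
  · have hS := Fintype.card_pos (α := S)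
    have hA := Fintype.card_pos (α := A)
    have hS1 : Fintype.card S ≤ 1 := by nlinarith
    have : Subsingleton S := Fintype.card_le_one_iff_subsingleton.1 hS1
    have := SlaterEstimation.subsingleton_pmf S
    -- With one state only one `P` exists, so `ζ` is known and can be output without sampling. The
    -- logarithm in the bound may be arbitrarily close to 0 here.
    refine ⟨fun _ _ => some (SlaterEstimation.slater (fun s _ => PMF.pure s) ρ γ c b),
      fun h => absurd h hcard, fun P hζ hζ1 => ?_⟩
    obtain rfl : P = fun s _ => PMF.pure s := Subsingleton.elim _ _
    set ζ := SlaterEstimation.slater (fun s (_ : A) => PMF.pure s) ρ γ c b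
    have hlog : 0 ≤ Real.log ((Fintype.card S : ℝ) * (Fintype.card A : ℝ) /
        ((1 - γ) * δ * ζ)) := by
      refine Real.log_nonneg ?_
      rw [le_div_iff₀ (by positivity)]
      rw [le_div_iff₀ hg] at hζ1
      have h1 := SlaterEstimation.one_le_card_mul_card S A
      have h2 := mul_le_one₀ hδ1.le (by positivity) hζ1
      linarith
    have hC := SlaterEstimation.cMax_nonneg hc0
    refine le_trans (ENNReal.ofReal_le_one.2 (by linarith)) ?_
    rw [← measure_univ (μ := SlaterEstimation.sampleLaw fun (s : S) (_ : A) => PMF.pure s)]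
    refine measure_mono fun ω _ => ⟨0, ζ, ⟨fun m hm => absurd hm (Nat.not_lt_zero m), rfl⟩, ?_, ?_⟩
    · rw [Nat.cast_zero]
      positivity
    · rw [sub_self, abs_zero]
      positivity
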